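/- Let $T\in(0,\infty)$, $d\in\{1,2,\dots\}$, and let $X=(X_t)_{t\in[0,T]}$ be an $\mathbb{R}^d$-valued stochastic process on a probability space $(\Omega,\mathcal F,\mathbb P)$ whose paths are almost surely continuous. Write $\|\cdot\|$ and $\langle\cdot,\cdot\rangle$ for the Euclidean norm and inner product. Let $\alpha\in(0,\frac1d)$, $\theta\ge 0$ and $\iota\in[0,1]$, and assume the following. (A1) There is a constant $C_0>0$ such that for every integer $m\ge1$, all $\xi_j=(\xi_{j,1},\dots,\xi_{j,d})\in(\mathbb{R}\setminus\{0\})^d$ ($1\le j\le m$), all $0=t_0<t_1<\dots<t_m<T$ and every choice of exponents $k_{j,l}\in\{0,4\}$ ($1\le j\le m$, $1\le l\le d$), $$\Big|\mathbb{E}\Big[\exp\Big(i\sum_{j=1}^m\langle\xi_j,X_{t_j}-X_{t_{j-1}}\rangle\Big)\Big]\Big|\le C_0^m\,m^{\alpha\theta m}\prod_{j=1}^m\prod_{l=1}^d\frac{1}{|\xi_{j,l}|^{k_{j,l}}(t_j-t_{j-1})^{\alpha k_{j,l}}}.$$ (A2) There is a constant $C_0'>0$ such that for every real $p\ge1$ and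 all $0\le s\le t\le T$, $$\mathbb{E}\big[\|X_t-X_s\|^p\big]\le (C_0')^p\,p^{p\iota}\,|t-s|^{p\alpha}.$$ Then there is a deterministic constant $C\in(0,\infty)$ such that for every $s\in[0,T]$, almost surely, $$\liminf_{r\downarrow0}\ \sup_{t\in(s-r,s+r)\cap[0,T]}\frac{\|X_t-X_s\|}{r^{\alpha d}(\log\log r^{-1})^{-\alpha(d+\theta)}}\ge C,$$ and, almost surely, $$\liminf_{r\downarrow0}\ \inf_{s\in[0,T]}\ \sup_{t\in(s-r,s+r)\cap[0,T]}\frac{\|X_t-X_s\|}{r^{\alpha d}(\log r^{-1})^{-\alpha(d+\theta)}}\ge C.$$ In particular, almost surely, the path $t\mapsto X_t$ is differentiable at no point of $[0,T]$ (at the endpoints $0$ and $T$, one-sided differentiability is meant). -/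

import Mathlib

open MeasureTheory Set Filter Topology

/-- Condition (A1), an upper bound for the characteristic function of the increments of a process
`X` on `[0, T]` along every finite partition `0 = t 0 < t 1 < ⋯ < t m < T`: the constant `C` is
uniform in `m`, in the partition, in the frequencies `ξ j` (all coordinates non-zero), and in the
exponents `k j l`, each of which may be chosen freely in `{0, 4}`. -/
def CharFunCondition {Ω : Type*} [MeasurableSpace Ω] (P : Measure Ω) {d : ℕ} (T : ℝ)
    (X : ℝ → Ω → EuclideanSpace ℝ (Fin d)) (α θ : ℝ) : Prop :=
  ∃ C : ℝ, 0 < C ∧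
    ∀ m : ℕ, 1 ≤ m →
    ∀ ξ : Fin m → EuclideanSpace ℝ (Fin d), (∀ j l, ξ j l ≠ 0) →
    ∀ k : Fin m → Fin d → ℕ, (∀ j l, k j l = 0 ∨ k j l = 4) →
    ∀ t : Fin (m + 1) → ℝ, StrictMono t → t 0 = 0 → t (Fin.last m) < T →
      ‖∫ ω, Complex.exp (Complex.I *
          ((∑ j : Fin m, inner ℝ (ξ j) (X (t j.succ) ω - X (t j.castSucc) ω) : ℝ) : ℂ)) ∂P‖
        ≤ C ^ m * (m : ℝ) ^ (α * θ * (m : ℝ)) *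
          ∏ j : Fin m, ∏ l : Fin d,
            1 / (|ξ j l| ^ (k j l) * (t j.succ - t j.castSucc) ^ (α * (k j l : ℝ)))

/-- Condition (A2), the moment bound `E ‖X t - X s‖ ^ p ≤ C ^ p * p ^ (p * ι) * |t - s| ^ (p * α)`
for all real `p ≥ 1` and `0 ≤ s ≤ t ≤ T`. The expectation is a Lebesgue integral with values in
`[0, ∞]`, so that its finiteness is part of the condition. -/
def MomentCondition {Ω : Type*} [MeasurableSpace Ω] (P : Measure Ω) {d : ℕ} (T : ℝ)
    (X : ℝ → Ω → EuclideanSpace ℝ (Fin d)) (α ι : ℝ) : Prop :=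
  ∃ C : ℝ, 0 < C ∧
    ∀ p : ℝ, 1 ≤ p → ∀ s t : ℝ, 0 ≤ s → s ≤ t → t ≤ T →
      ∫⁻ ω, ENNReal.ofReal (‖X t ω - X s ω‖ ^ p) ∂P
        ≤ ENNReal.ofReal (C ^ p * p ^ (p * ι) * |t - s| ^ (p * α))

/-!
The proof goes through a small ball estimate for a single coordinate of `X`; no local time enters.

Fix a window `[a, a + ρ] ⊆ [0, T]` and an equidistant grid in it whose `n` increments `Y j` of one
coordinate have time step `ρ / (n + 2)`. The event `|Y j| ≤ δ` for all `j` has probability at most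
`exp (n / 2) * E (∏ j, exp (-(Y j / δ) ^ 2 / 2))`, and the Gaussian function is itself a
characteristic function, so this expectation is the average of the joint characteristic function of
the `Y j` over independent standard normal frequencies
(`measureReal_forall_abs_le_of_charFun_bound`). The characteristic function condition, with `k = 4`
for large and `k = 0` for small frequencies, makes every frequency integrable and yields a factor
`δ * ((n + 2) / ρ) ^ α` for each `j`; together with the prefactor `n ^ (α * θ * n)` this shows that
for `δ = c * ρ ^ α * (n + 2) ^ (-α * (1 + θ))` with `c` small the event has probability at most
`exp (-2 * n)` (`exists_measure_smallIncrements_le_exp`).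

Off this event the oscillation of `X` in the window about any point of space is at least `δ / 2`.
Take the windows to be the dyadic cells of `[0, T]` of length `ρ = T / 2 ^ k`. At a fixed time one
cell for each `k` is needed, and `n` of order `log k` makes the probabilities summable; uniformly in
time there are `2 ^ k` cells, and `n = k + 1` suffices. The Borel–Cantelli lemma then gives almost
surely an oscillation of order `r ^ α * ℓ ^ (-α * (1 + θ))`, where `ℓ` is `log (log r⁻¹)` or
`log r⁻¹` (`exists_oscillation_lower_bound`). Since `1 ≤ d`, this is at least of the order
`r ^ (α * d) * ℓ ^ (-α * (d + θ))`. As `α * d < 1`, the uniform bound exceeds every linear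
modulus, which excludes differentiability at every time simultaneously.
-/

/-! ### The characteristic function of one coordinate -/

theorem one_div_pow_four_le_two_div_one_add_sq {u : ℝ} (hu : 1 ≤ u) :
    1 / u ^ 4 ≤ 2 / (1 + u ^ 2) := by
  rw [div_le_div_iff₀ (by positivity) (by positivity)]
  nlinarith [sq_nonneg u, one_le_pow₀ hu (n := 2), mul_self_nonneg (u ^ 2 - 1)]

/-- The characteristic function condition for a single coordinate, the choice of the exponents being
absorbed in an integrable majorant. All frequencies are admitted here: those that the condition
requires to be non-zero are perturbed and then sent to zero. -/
theorem CharFunCondition.exists_coord_bound {Ω : Type*} [MeasurableSpace Ω] {P : Measure Ω}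
    [IsProbabilityMeasure P] {d : ℕ} {T : ℝ} {X : ℝ → Ω → EuclideanSpace ℝ (Fin d)} {α θ : ℝ}
    (hXmeas : ∀ t ∈ Icc 0 T, Measurable (X t)) (hA1 : CharFunCondition P T X α θ) (l₀ : Fin d) :
    ∃ C : ℝ, 1 ≤ C ∧ ∀ m : ℕ, 1 ≤ m → ∀ ξ : Fin m → ℝ, ∀ t : Fin (m + 1) → ℝ, StrictMono t →
      t 0 = 0 → t (Fin.last m) < T →
      ‖∫ ω, Complex.exp (Complex.I *
          ((∑ j : Fin m, ξ j * (X (t j.succ) ω l₀ - X (t j.castSucc) ω l₀) : ℝ) : ℂ)) ∂P‖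
        ≤ C ^ m * (m : ℝ) ^ (α * θ * (m : ℝ)) *
          ∏ j : Fin m, 2 / (1 + (ξ j * (t j.succ - t j.castSucc) ^ α) ^ 2) := by
  obtain ⟨C, hC, h⟩ := hA1
  refine ⟨max C 1, le_max_right _ _, fun m hm ξ t ht ht0 htT => ?_⟩
  have hmem : ∀ j, t j ∈ Icc 0 T := fun j =>
    ⟨ht0 ▸ ht.monotone (Fin.zero_le j), (ht.monotone (Fin.le_last j)).trans htT.le⟩
  have hΔ : ∀ j : Fin m, 0 < t j.succ - t j.castSucc := fun j =>
    sub_pos.2 (ht Fin.castSucc_lt_succ)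
  -- `v ε` replaces every vanishing frequency, and those of the other coordinates, by `ε`; the
  -- exponents `k` are zero there, so the resulting bound does not depend on `ε`.
  let v : ℝ → Fin m → EuclideanSpace ℝ (Fin d) := fun ε j =>
    WithLp.toLp 2 fun l => if l = l₀ ∧ ξ j ≠ 0 then ξ j else ε
  let k : Fin m → Fin d → ℕ := fun j l =>
    if l = l₀ ∧ 1 ≤ |ξ j| * (t j.succ - t j.castSucc) ^ α then 4 else 0
  let F : ℝ → Ω → ℂ := fun ε ω => Complex.exp (Complex.I *
    ((∑ j : Fin m, inner ℝ (v ε j) (X (t j.succ) ω - X (t j.castSucc) ω) : ℝ) : ℂ))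
  have hv : ∀ j, Continuous fun ε => v ε j := by
    intro j
    refine (PiLp.continuous_toLp 2 _).comp (continuous_pi fun l => ?_)
    split_ifs <;> fun_prop
  have hv0 : ∀ j ω, inner ℝ (v 0 j) (X (t j.succ) ω - X (t j.castSucc) ω)
      = ξ j * (X (t j.succ) ω l₀ - X (t j.castSucc) ω l₀) := by
    intro j ω
    rw [PiLp.inner_apply, Finset.sum_eq_single l₀]
    · by_cases hξ : ξ j = 0 <;> simp [v, hξ, mul_comm]
    · intro l _ hl
      simp [v, hl]
    · simp
  have hlim : Tendsto (fun ε => ‖∫ ω, F ε ω ∂P‖) (𝓝[≠] 0) (𝓝 ‖∫ ω, F 0 ω ∂P‖) := by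
    refine (Tendsto.norm ?_)
    refine tendsto_integral_filter_of_dominated_convergence (fun _ => 1) ?_ ?_
      (integrable_const _) ?_
    · refine Eventually.of_forall fun ε => Measurable.aestronglyMeasurable ?_
      have : ∀ j, Measurable fun ω =>
          inner ℝ (v ε j) (X (t (Fin.succ j)) ω - X (t (Fin.castSucc j)) ω) := fun j =>
        measurable_const.inner ((hXmeas _ (hmem _)).sub (hXmeas _ (hmem _)))
      refine Complex.measurable_exp.comp (measurable_const.mul (Complex.measurable_ofReal.comp ?_))
      exact Finset.measurable_sum _ fun j _ => this j
    · refine Eventually.of_forall fun ε => Eventually.of_forall fun ω => ?_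
      simp only [F]
      rw [mul_comm, Complex.norm_exp_ofReal_mul_I]
    · refine Eventually.of_forall fun ω => ?_
      have : Continuous fun ε => F ε ω := by
        refine Complex.continuous_exp.comp
          (continuous_const.mul (Complex.continuous_ofReal.comp ?_))
        exact continuous_finsetSum _ fun j _ => (hv j).inner continuous_const
      exact (this.tendsto 0).mono_left nhdsWithin_le_nhds
  have hF0 : ∀ ω, F 0 ω = Complex.exp (Complex.I *
      ((∑ j : Fin m, ξ j * (X (t j.succ) ω l₀ - X (t j.castSucc) ω l₀) : ℝ) : ℂ)) := by
    intro ω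
    simp only [F, hv0]
  simp only [← hF0]
  refine le_of_tendsto hlim ?_
  filter_upwards [self_mem_nhdsWithin] with ε hε
  have hε : ε ≠ 0 := hε
  refine (h m hm (v ε) ?_ k ?_ t ht ht0 htT).trans ?_
  · intro j l
    by_cases hl : l = l₀ ∧ ξ j ≠ 0
    · simp [v, hl]
    · simpa [v, hl] using hε
  · intro j l
    by_cases hl : l = l₀ ∧ 1 ≤ |ξ j| * (t j.succ - t j.castSucc) ^ α
    · right; simp only [k, if_pos hl]
    · left; simp only [k, if_neg hl]
  have hterm : ∀ j, ∏ l : Fin d, 1 / (|v ε j l| ^ (k j l) *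
      (t j.succ - t j.castSucc) ^ (α * (k j l : ℝ)))
        ≤ 2 / (1 + (ξ j * (t j.succ - t j.castSucc) ^ α) ^ 2) := by
    intro j
    set s := t j.succ - t j.castSucc with hs
    have hsp : 0 < s := hΔ j
    rw [Finset.prod_eq_single l₀]
    · have hsq : (ξ j * s ^ α) ^ 2 = (|ξ j| * s ^ α) ^ 2 := by
        rw [mul_pow, mul_pow, sq_abs]
      rw [hsq]
      by_cases hu : 1 ≤ |ξ j| * s ^ α
      · have hk : k j l₀ = 4 := if_pos ⟨rfl, hu⟩
        have hξ : ξ j ≠ 0 := by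
          rintro h0
          rw [h0] at hu
          norm_num at hu
        have hvv : v ε j l₀ = ξ j := by simp [v, hξ]
        rw [hk, hvv, show s ^ (α * ((4 : ℕ) : ℝ)) = (s ^ α) ^ 4 by
          rw [Real.rpow_mul hsp.le, Real.rpow_natCast], ← mul_pow]
        exact one_div_pow_four_le_two_div_one_add_sq hu
      · have hk : k j l₀ = 0 := if_neg fun h => hu h.2
        rw [hk]
        push Not at hu
        have h0 : 0 ≤ |ξ j| * s ^ α := by positivity
        simp only [pow_zero, Nat.cast_zero, mul_zero, Real.rpow_zero, mul_one, div_one]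
        rw [le_div_iff₀ (by positivity)]
        nlinarith
    · intro l _ hl
      have hk : k j l = 0 := if_neg fun h => hl h.1
      simp [hk]
    · simp
  have h1 : ∀ j, 0 ≤ ∏ l : Fin d, 1 / (|v ε j l| ^ (k j l) *
      (t j.succ - t j.castSucc) ^ (α * (k j l : ℝ))) := by
    intro j
    have := (hΔ j).le
    exact Finset.prod_nonneg fun l _ => by positivity
  refine mul_le_mul ?_ (Finset.prod_le_prod (fun j _ => h1 j) fun j _ => hterm j)
    (Finset.prod_nonneg fun j _ => h1 j) (by positivity)
  gcongr
  exact le_max_left _ _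

/-! ### Gaussian smoothing -/

open ProbabilityTheory in
theorem integral_gaussianReal_two_div_one_add_sq_le {a : ℝ} (ha : 0 < a) :
    ∫ x, 2 / (1 + (x * a) ^ 2) ∂(gaussianReal 0 1) ≤ 2 * Real.pi / a := by
  have hint : Integrable fun x : ℝ => (1 + (x * a) ^ 2)⁻¹ :=
    integrable_inv_one_add_sq.comp_mul_right' ha.ne'
  rw [integral_gaussianReal_eq_integral_smul one_ne_zero]
  calc ∫ x, gaussianPDFReal 0 1 x • (2 / (1 + (x * a) ^ 2))
      ≤ ∫ x : ℝ, 2 * (1 + (x * a) ^ 2)⁻¹ := by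
        refine integral_mono_of_nonneg (Eventually.of_forall fun x => ?_) (hint.const_mul 2)
          (Eventually.of_forall fun x => ?_)
        · have := gaussianPDFReal_nonneg 0 1 x
          simp only [smul_eq_mul, Pi.zero_apply]
          positivity
        · have h1 : gaussianPDFReal 0 1 x ≤ 1 := by
            rw [gaussianPDFReal]
            refine mul_le_one₀ ?_ (Real.exp_pos _).le ?_
            · refine inv_le_one_of_one_le₀ (Real.one_le_sqrt.2 ?_)
              have := Real.pi_gt_three
              simp only [NNReal.coe_one, mul_one]
              linarith
            · rw [Real.exp_le_one_iff]
              simp only [NNReal.coe_one]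
              have := sq_nonneg (x - 0)
              rw [neg_div]
              linarith [this]
          simp only [smul_eq_mul, div_eq_mul_inv]
          exact mul_le_of_le_one_left (by positivity) h1
    _ = 2 * Real.pi / a := by
        rw [integral_const_mul, Measure.integral_comp_mul_right (fun y : ℝ => (1 + y ^ 2)⁻¹) a,
          integral_univ_inv_one_add_sq, abs_of_pos (inv_pos.2 ha), smul_eq_mul]
        ring

open ProbabilityTheory in
/-- A product of Gaussian functions is the characteristic function of independent standard
normal variables. -/
theorem integral_pi_gaussianReal_exp {n : ℕ} (y : Fin n → ℝ) :
    ∫ x : Fin n → ℝ, Complex.exp (Complex.I * ((∑ j, x j * y j : ℝ) : ℂ))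
      ∂(Measure.pi fun _ => gaussianReal 0 1) = ((∏ j, Real.exp (-(y j) ^ 2 / 2) : ℝ) : ℂ) := by
  have : ∀ x : Fin n → ℝ, Complex.exp (Complex.I * ((∑ j, x j * y j : ℝ) : ℂ))
      = ∏ j, Complex.exp (y j * x j * Complex.I) := by
    intro x
    rw [← Complex.exp_sum]
    congr 1
    push_cast
    rw [Finset.mul_sum]
    exact Finset.sum_congr rfl fun j _ => by ring
  simp only [this]
  rw [integral_fintype_prod_eq_prod (𝕜 := ℂ)
    (fun j (x : ℝ) => Complex.exp (y j * x * Complex.I))]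
  push_cast
  refine Finset.prod_congr rfl fun j _ => ?_
  rw [← charFun_apply_real, charFun_gaussianReal]
  congr 1
  push_cast
  ring

open ProbabilityTheory in
/-- A bound on the joint characteristic function of `Y` that is integrable at scale `1 / σ` in each
frequency bounds the probability that all `Y j` are small: morally `Y` has a joint density of size
`B * (const / σ) ^ n`. -/
theorem measureReal_forall_abs_le_of_charFun_bound {Ω : Type*} [MeasurableSpace Ω] {P : Measure Ω}
    [IsProbabilityMeasure P] {n : ℕ} {Y : Fin n → Ω → ℝ} (hY : ∀ j, Measurable (Y j))
    {B σ δ : ℝ} (hB : 0 ≤ B) (hσ : 0 < σ) (hδ : 0 < δ)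
    (h : ∀ ξ : Fin n → ℝ, ‖∫ ω, Complex.exp (Complex.I * ((∑ j, ξ j * Y j ω : ℝ) : ℂ)) ∂P‖
      ≤ B * ∏ j, 2 / (1 + (ξ j * σ) ^ 2)) :
    P.real {ω | ∀ j, |Y j ω| ≤ δ} ≤ B * (Real.exp (1 / 2) * (2 * Real.pi) * (δ / σ)) ^ n := by
  set γ : Measure (Fin n → ℝ) := Measure.pi fun _ => gaussianReal 0 1 with hγ
  set f : Ω → ℝ := fun ω => ∏ j, Real.exp (-(Y j ω / δ) ^ 2 / 2) with hf
  have hf0 : ∀ ω, 0 ≤ f ω := fun ω => Finset.prod_nonneg fun j _ => (Real.exp_pos _).le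
  have hf1 : ∀ ω, f ω ≤ 1 := fun ω => Finset.prod_le_one (fun j _ => (Real.exp_pos _).le)
    fun j _ => by
      rw [Real.exp_le_one_iff, neg_div]
      have := sq_nonneg (Y j ω / δ)
      linarith
  have hfm : Measurable f := by
    refine Finset.measurable_prod _ fun j _ => ?_
    have := hY j
    fun_prop
  have hfi : Integrable f P := by
    refine Integrable.of_bound hfm.aestronglyMeasurable 1 (Eventually.of_forall fun ω => ?_)
    rw [Real.norm_of_nonneg (hf0 ω)]
    exact hf1 ω
  have hmarkov : Real.exp (-(n / 2)) * P.real {ω | ∀ j, |Y j ω| ≤ δ} ≤ ∫ ω, f ω ∂P := by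
    refine le_trans ?_ (mul_meas_ge_le_integral_of_nonneg (Eventually.of_forall hf0) hfi
      (Real.exp (-(n / 2))))
    gcongr
    · finiteness
    rename_i ω
    intro hω
    simp only [hf, ← Real.exp_sum, Real.exp_le_exp] at hω ⊢
    have : ∀ j ∈ Finset.univ, (-(1 / 2) : ℝ) ≤ -(Y j ω / δ) ^ 2 / 2 := by
      intro j _
      have h1 : |Y j ω / δ| ≤ 1 := by
        rw [abs_div, abs_of_pos hδ, div_le_one hδ]
        exact hω j
      have h2 := (sq_le_one_iff_abs_le_one _).2 h1
      linarith
    have h3 := Finset.sum_le_sum this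
    simp only [Finset.sum_const, Finset.card_univ, Fintype.card_fin, nsmul_eq_mul] at h3
    linarith
  have hint : ∫ ω, f ω ∂P ≤ B * (2 * Real.pi * (δ / σ)) ^ n := by
    have hswap : ((∫ ω, f ω ∂P : ℝ) : ℂ) = ∫ x, ∫ ω, Complex.exp (Complex.I *
        ((∑ j, x j / δ * Y j ω : ℝ) : ℂ)) ∂P ∂γ := by
      rw [← integral_complex_ofReal, integral_integral_swap]
      · refine integral_congr_ae (Eventually.of_forall fun ω => ?_)
        simp only [hf]
        rw [← integral_pi_gaussianReal_exp]
        simp only [div_mul_eq_mul_div, mul_div_assoc]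
        rfl
      · refine Integrable.of_bound (C := 1) (Measurable.aestronglyMeasurable ?_)
          (Eventually.of_forall fun z => ?_)
        · refine Complex.measurable_exp.comp
            (measurable_const.mul (Complex.measurable_ofReal.comp ?_))
          refine Finset.measurable_sum _ fun j _ => ?_
          have := hY j
          fun_prop
        · rw [Function.uncurry, mul_comm, Complex.norm_exp_ofReal_mul_I]
    have hnorm : ∫ ω, f ω ∂P = ‖((∫ ω, f ω ∂P : ℝ) : ℂ)‖ := by
      rw [Complex.norm_real, Real.norm_of_nonneg (integral_nonneg hf0)]
    have hpos : ∀ x : ℝ, 0 ≤ 2 / (1 + (x * (σ / δ)) ^ 2) := fun x => by positivity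
    have hle2 : ∀ x : ℝ, 2 / (1 + (x * (σ / δ)) ^ 2) ≤ 2 := fun x =>
      div_le_self zero_le_two (by nlinarith [sq_nonneg (x * (σ / δ))])
    have hgi : Integrable (fun x : ℝ => 2 / (1 + (x * (σ / δ)) ^ 2)) (gaussianReal 0 1) := by
      refine Integrable.of_bound (C := 2) (Measurable.aestronglyMeasurable (by fun_prop))
        (Eventually.of_forall fun x => ?_)
      rw [Real.norm_of_nonneg (hpos x)]
      exact hle2 x
    rw [hnorm, hswap]
    calc ‖∫ x, ∫ ω, Complex.exp (Complex.I * ((∑ j, x j / δ * Y j ω : ℝ) : ℂ)) ∂P ∂γ‖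
        ≤ ∫ x, B * ∏ j, 2 / (1 + (x j * (σ / δ)) ^ 2) ∂γ := by
          refine norm_integral_le_of_norm_le ?_ (Eventually.of_forall fun x => ?_)
          · exact (Integrable.fintype_prod (𝕜 := ℝ) fun _ => hgi).const_mul B
          · refine (h fun j => x j / δ).trans_eq ?_
            simp only [div_mul_eq_mul_div, mul_div_assoc]
      _ = B * (∫ x, 2 / (1 + (x * (σ / δ)) ^ 2) ∂(gaussianReal 0 1)) ^ n := by
          rw [integral_const_mul, hγ, integral_fintype_prod_eq_prod (𝕜 := ℝ)
            (fun _ (x : ℝ) => 2 / (1 + (x * (σ / δ)) ^ 2))]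
          simp
      _ ≤ B * (2 * Real.pi * (δ / σ)) ^ n := by
          refine mul_le_mul_of_nonneg_left (pow_le_pow_left₀ (integral_nonneg hpos) ?_ n) hB
          · refine (integral_gaussianReal_two_div_one_add_sq_le (div_pos hσ hδ)).trans_eq ?_
            field_simp
  have hexp : Real.exp (1 / 2) ^ n * Real.exp (-(n / 2)) = 1 := by
    rw [← Real.exp_nat_mul, ← Real.exp_add, Real.exp_eq_one_iff]
    ring
  calc P.real {ω | ∀ j, |Y j ω| ≤ δ}
      = Real.exp (1 / 2) ^ n * (Real.exp (-(n / 2)) * P.real {ω | ∀ j, |Y j ω| ≤ δ}) := by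
        rw [← mul_assoc, hexp, one_mul]
    _ ≤ Real.exp (1 / 2) ^ n * (B * (2 * Real.pi * (δ / σ)) ^ n) := by
        exact mul_le_mul_of_nonneg_left (hmarkov.trans hint) (by positivity)
    _ = B * (Real.exp (1 / 2) * (2 * Real.pi) * (δ / σ)) ^ n := by
        rw [mul_assoc (Real.exp (1 / 2)), mul_pow (Real.exp (1 / 2))]
        ring

/-! ### Small increments in a window -/

/-- The `i`-th of the `n + 1` points, indexed from zero, that divide `[a, a + ρ]` into `n + 2` equal
parts. The two endpoints are left out: the condition on characteristic functions concerns times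
strictly between `0` and `T` only. -/
noncomputable def gridPoint (a ρ : ℝ) (n i : ℕ) : ℝ := a + ρ * ((i + 1) / (n + 2))

/-- The event that all `n` increments of the coordinate `l` along the grid in `[a, a + ρ]` are at
most `δ` in absolute value. -/
def smallIncrements {Ω : Type*} {d : ℕ} (X : ℝ → Ω → EuclideanSpace ℝ (Fin d)) (l : Fin d)
    (a ρ : ℝ) (n : ℕ) (δ : ℝ) : Set Ω :=
  {ω | ∀ j : Fin n,
    |X (gridPoint a ρ n (j + 1)) ω l - X (gridPoint a ρ n j) ω l| ≤ δ}

theorem gridPoint_mem_Ioo {a ρ : ℝ} (hρ : 0 < ρ) {n i : ℕ} (hi : i ≤ n) :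
    gridPoint a ρ n i ∈ Ioo a (a + ρ) := by
  have hi' : (i : ℝ) ≤ n := by exact_mod_cast hi
  have h1 : ((i : ℝ) + 1) / (n + 2) < 1 := by
    rw [div_lt_one (by positivity)]
    linarith
  have h0 : 0 < ((i : ℝ) + 1) / (n + 2) := by positivity
  refine ⟨?_, ?_⟩ <;> rw [gridPoint] <;> nlinarith

theorem gridPoint_succ_sub {a ρ : ℝ} {n i : ℕ} :
    gridPoint a ρ n (i + 1) - gridPoint a ρ n i = ρ / (n + 2) := by
  rw [gridPoint, gridPoint]
  push_cast
  ring

theorem exists_measureReal_smallIncrements_le {Ω : Type*} [MeasurableSpace Ω] {P : Measure Ω}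
    [IsProbabilityMeasure P] {d : ℕ} {T : ℝ} {X : ℝ → Ω → EuclideanSpace ℝ (Fin d)} {α θ : ℝ}
    (hXmeas : ∀ t ∈ Icc 0 T, Measurable (X t)) (hA1 : CharFunCondition P T X α θ) (l : Fin d) :
    ∃ C : ℝ, 1 ≤ C ∧ ∀ (n : ℕ) (a ρ δ : ℝ), 0 ≤ a → 0 < ρ → a + ρ ≤ T → 0 < δ →
      P.real (smallIncrements X l a ρ n δ) ≤
        2 * C ^ (n + 1) * ((n + 1 : ℕ) : ℝ) ^ (α * θ * ((n + 1 : ℕ) : ℝ)) *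
          (Real.exp (1 / 2) * (2 * Real.pi) * (δ / (ρ / (n + 2)) ^ α)) ^ n := by
  obtain ⟨C, hC, h⟩ := hA1.exists_coord_bound hXmeas l
  refine ⟨C, hC, fun n a ρ δ ha hρ haT hδ => ?_⟩
  have hmem : ∀ i ≤ n, gridPoint a ρ n i ∈ Icc 0 T := fun i hi =>
    ⟨ha.trans (gridPoint_mem_Ioo hρ hi).1.le, (gridPoint_mem_Ioo hρ hi).2.le.trans haT⟩
  let t : Fin (n + 1 + 1) → ℝ := Fin.cons 0 fun j : Fin (n + 1) => gridPoint a ρ n j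
  have ht0 : t 0 = 0 := rfl
  have hts : ∀ j : Fin (n + 1), t j.succ = gridPoint a ρ n j := fun j => by
    simp [t]
  have hstep : ∀ i, gridPoint a ρ n i < gridPoint a ρ n (i + 1) := fun i => by
    rw [← sub_pos, gridPoint_succ_sub]
    positivity
  have ht : StrictMono t := by
    rw [Fin.strictMono_iff_lt_succ]
    intro i
    rw [hts]
    refine Fin.cases ?_ (fun i => ?_) i
    · exact ha.trans_lt (gridPoint_mem_Ioo hρ (Nat.zero_le n)).1
    · rw [← Fin.succ_castSucc, hts]
      exact hstep i
  have htT : t (Fin.last (n + 1)) < T := by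
    rw [← Fin.succ_last, hts]
    exact (gridPoint_mem_Ioo hρ le_rfl).2.trans_le haT
  let Y : Fin n → Ω → ℝ := fun j ω =>
    X (gridPoint a ρ n (j + 1)) ω l - X (gridPoint a ρ n j) ω l
  have hX : ∀ i ≤ n, Measurable fun ω => X (gridPoint a ρ n i) ω l := fun i hi =>
    (EuclideanSpace.proj l : EuclideanSpace ℝ (Fin d) →L[ℝ] ℝ).continuous.measurable.comp
      (hXmeas _ (hmem i hi))
  refine measureReal_forall_abs_le_of_charFun_bound (Y := Y) (σ := (ρ / (n + 2)) ^ α)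
    (fun j => (hX _ j.2).sub (hX _ j.2.le)) (by positivity) (by positivity) hδ fun ξ => ?_
  -- The increment from time `0` to the first grid point gets frequency `0`.
  have key := h (n + 1) (by lia) (Fin.cons 0 ξ) t ht ht0 htT
  simp only [Fin.sum_univ_succ, Fin.prod_univ_succ, Fin.cons_zero, Fin.cons_succ, zero_mul,
    zero_add, hts, ← Fin.succ_castSucc, Fin.val_succ, Fin.val_castSucc, gridPoint_succ_sub] at key
  refine key.trans_eq ?_
  norm_num
  ring

/-- The small ball estimate: with `δ` of order `ρ ^ α * (n + 2) ^ (-α * (1 + θ))`, small increments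
in a window of length `ρ` have probability at most `exp (-2 * n)`. -/
theorem exists_measure_smallIncrements_le_exp {Ω : Type*} [MeasurableSpace Ω] {P : Measure Ω}
    [IsProbabilityMeasure P] {d : ℕ} {T : ℝ} {X : ℝ → Ω → EuclideanSpace ℝ (Fin d)} {α θ : ℝ}
    (hα : 0 < α) (hθ : 0 ≤ θ)
    (hXmeas : ∀ t ∈ Icc 0 T, Measurable (X t)) (hA1 : CharFunCondition P T X α θ) (l : Fin d) :
    ∃ c : ℝ, 0 < c ∧ ∀ (n : ℕ) (a ρ : ℝ), 1 ≤ n → 0 ≤ a → 0 < ρ → a + ρ ≤ T →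
      P (smallIncrements X l a ρ n (c * ρ ^ α * ((n : ℝ) + 2) ^ (-(α * (1 + θ))))) ≤
        ENNReal.ofReal (Real.exp (-(2 * n))) := by
  obtain ⟨C, hC, h⟩ := exists_measureReal_smallIncrements_le hXmeas hA1 l
  set D := Real.exp (1 / 2) * (2 * Real.pi) with hD
  have hDpos : 0 < D := by positivity
  set A := 2 * C ^ 2 * Real.exp (3 * (α * θ)) * D * Real.exp 2 with hA
  have hApos : 0 < A := by positivity
  -- `A⁻¹` offsets all factors that are exponential in `n`, namely `C`, the Gaussian constant `D`
  -- and the excess of `(n + 1) ^ (α * θ * (n + 1))` over `N ^ (α * θ * n)`, and leaves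
  -- `exp (-2 * n)`.
  refine ⟨A⁻¹, inv_pos.2 hApos, fun n a ρ hn ha hρ haT => ?_⟩
  set N : ℝ := (n : ℝ) + 2 with hN
  have hn' : (1 : ℝ) ≤ n := by exact_mod_cast hn
  have hNpos : 0 < N := by positivity
  have hαθ : 0 ≤ α * θ := mul_nonneg hα.le hθ
  rw [← ofReal_measureReal]
  refine ENNReal.ofReal_le_ofReal ((h n a ρ _ ha hρ haT (by positivity)).trans ?_)
  have hquot : A⁻¹ * ρ ^ α * N ^ (-(α * (1 + θ))) / (ρ / N) ^ α = A⁻¹ * (N ^ (α * θ))⁻¹ := by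
    rw [Real.div_rpow hρ.le hNpos.le, show -(α * (1 + θ)) = -α + -(α * θ) by ring,
      Real.rpow_add hNpos, Real.rpow_neg hNpos.le, Real.rpow_neg hNpos.le]
    have := (Real.rpow_pos_of_pos hρ α).ne'
    have := (Real.rpow_pos_of_pos hNpos α).ne'
    field_simp
  rw [hquot]
  have hpow : ((n + 1 : ℕ) : ℝ) ^ (α * θ * ((n + 1 : ℕ) : ℝ)) ≤
      (N ^ (α * θ)) ^ n * Real.exp (3 * (α * θ)) ^ n := by
    calc ((n + 1 : ℕ) : ℝ) ^ (α * θ * ((n + 1 : ℕ) : ℝ))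
        ≤ N ^ (α * θ * ((n + 1 : ℕ) : ℝ)) := by
          refine Real.rpow_le_rpow (by positivity) ?_ (by positivity)
          push_cast
          linarith
      _ = (N ^ (α * θ)) ^ n * N ^ (α * θ) := by
          rw [Real.rpow_mul hNpos.le, Real.rpow_natCast, pow_succ]
      _ ≤ (N ^ (α * θ)) ^ n * Real.exp (3 * (α * θ)) ^ n := by
          refine mul_le_mul_of_nonneg_left ?_ (by positivity)
          rw [Real.rpow_def_of_pos hNpos, ← Real.exp_nat_mul, Real.exp_le_exp]
          have h1 : Real.log N ≤ 3 * n :=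
            (Real.log_le_sub_one_of_pos hNpos).trans (by linarith)
          nlinarith
  have hCpow : 2 * C ^ (n + 1) ≤ (2 * C ^ 2) ^ n := by
    rw [mul_pow, ← pow_mul]
    exact mul_le_mul (le_self_pow₀ one_le_two (by lia)) (pow_le_pow_right₀ hC (by lia))
      (by positivity) (by positivity)
  have hNn : 0 < N ^ (α * θ) := by positivity
  calc 2 * C ^ (n + 1) * ((n + 1 : ℕ) : ℝ) ^ (α * θ * ((n + 1 : ℕ) : ℝ)) *
        (D * (A⁻¹ * (N ^ (α * θ))⁻¹)) ^ n
      ≤ (2 * C ^ 2) ^ n * ((N ^ (α * θ)) ^ n * Real.exp (3 * (α * θ)) ^ n) *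
        (D * (A⁻¹ * (N ^ (α * θ))⁻¹)) ^ n := by gcongr
    _ = ((2 * C ^ 2 * Real.exp (3 * (α * θ)) * D) * A⁻¹ *
          (N ^ (α * θ) * (N ^ (α * θ))⁻¹)) ^ n := by
        simp only [← mul_pow]
        congr 1
        ring
    _ = (Real.exp (-2)) ^ n := by
        rw [mul_inv_cancel₀ hNn.ne', mul_one, hA, Real.exp_neg]
        congr 1
        have := (Real.exp_pos 2).ne'
        have := (Real.exp_pos (3 * (α * θ))).ne'
        have : C ≠ 0 := by positivity
        field_simp
    _ = Real.exp (-(2 * n)) := by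
        rw [← Real.exp_nat_mul]
        congr 1
        ring

/-- One of the two ends of an increment exceeding `δ` lies at distance at least `δ / 2` from `x`. -/
theorem exists_norm_sub_ge_of_notMem_smallIncrements {Ω : Type*} {d : ℕ}
    {X : ℝ → Ω → EuclideanSpace ℝ (Fin d)} {l : Fin d} {a ρ δ : ℝ} {n : ℕ} {ω : Ω} (hρ : 0 < ρ)
    (hω : ω ∉ smallIncrements X l a ρ n δ) (x : EuclideanSpace ℝ (Fin d)) :
    ∃ t ∈ Ioo a (a + ρ), δ / 2 ≤ ‖X t ω - x‖ := by
  by_contra! hcon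
  refine hω fun j => ?_
  have h1 := hcon _ (gridPoint_mem_Ioo hρ (Nat.succ_le_of_lt j.2))
  have h2 := hcon _ (gridPoint_mem_Ioo hρ j.2.le)
  set u := X (gridPoint a ρ n (j + 1)) ω
  set v := X (gridPoint a ρ n j) ω
  calc |u l - v l| = ‖(u - v) l‖ := rfl
    _ ≤ ‖u - v‖ := PiLp.norm_apply_le _ _
    _ ≤ ‖u - x‖ + ‖v - x‖ := by
        rw [← sub_sub_sub_cancel_right u v x]
        exact norm_sub_le _ _
    _ ≤ δ := by linarith

/-! ### Dyadic cells -/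

theorem tendsto_log_inv_nhdsGT_zero :
    Tendsto (fun r : ℝ => Real.log r⁻¹) (𝓝[>] 0) atTop :=
  Real.tendsto_log_atTop.comp tendsto_inv_nhdsGT_zero

/-- Every small radius `r` lies within a factor `2` above a dyadic length `T / 2 ^ k`, with `k` in
any prescribed neighbourhood of infinity and of order at most `log r⁻¹`. -/
theorem eventually_exists_dyadic {T : ℝ} (hT : 0 < T) {p : ℕ → Prop}
    (hp : ∀ᶠ k in atTop, p k) :
    ∀ᶠ r : ℝ in 𝓝[>] 0, ∃ k, p k ∧ T / 2 ^ k < r ∧ r ≤ 2 * (T / 2 ^ k) ∧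
      (k : ℝ) + 1 ≤ 4 * Real.log r⁻¹ := by
  obtain ⟨K, hK⟩ := eventually_atTop.1 hp
  have hTK : 0 < T / 2 ^ K := by positivity
  filter_upwards [self_mem_nhdsWithin, mem_nhdsWithin_of_mem_nhds (Iio_mem_nhds hTK),
    tendsto_log_inv_nhdsGT_zero.eventually_ge_atTop (max 1 (Real.log (2 * T)))]
    with r (hr : 0 < r) (hrK : r < T / 2 ^ K) hlog
  have hrT : r < T := hrK.trans_le (div_le_self hT.le (one_le_pow₀ one_le_two))
  obtain ⟨k, hk1, hk2⟩ := exists_nat_pow_near_of_lt_one (y := (1 / 2 : ℝ)) (div_pos hr hT)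
    ((div_le_one hT).2 hrT.le) (by norm_num) (by norm_num)
  rw [lt_div_iff₀ hT, one_div, inv_pow, inv_mul_eq_div] at hk1
  rw [div_le_iff₀ hT, one_div, inv_pow, inv_mul_eq_div] at hk2
  have hhalf : 2 * (T / 2 ^ (k + 1)) = T / 2 ^ k := by
    rw [pow_succ]
    field_simp
  refine ⟨k + 1, hK _ ?_, hk1, hhalf.symm ▸ hk2, ?_⟩
  · by_contra! hlt
    have : T / 2 ^ K ≤ T / 2 ^ (k + 1) :=
      div_le_div_of_nonneg_left hT.le (by positivity) (pow_le_pow_right₀ one_le_two hlt.le)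
    linarith
  · have h2k : (2 : ℝ) ^ (k + 1) ≤ 2 * T * r⁻¹ := by
      rw [le_div_iff₀ (by positivity)] at hk2
      rw [← div_eq_mul_inv, le_div_iff₀ hr, pow_succ]
      linarith
    have hl := Real.log_le_log (by positivity) h2k
    rw [Real.log_pow, Real.log_mul (by positivity) (by positivity)] at hl
    have hl1 := (le_max_left _ _).trans hlog
    have hl2 := (le_max_right _ _).trans hlog
    have hlog2 := Real.log_two_gt_d9
    have hk0 : (0 : ℝ) ≤ ((k + 1 : ℕ) : ℝ) := Nat.cast_nonneg _
    nlinarith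

theorem exists_dyadic_cell {T s : ℝ} (hT : 0 < T) (hs : s ∈ Icc 0 T) (k : ℕ) :
    ∃ i : ℕ, i < 2 ^ k ∧ s ∈ Icc (i * (T / 2 ^ k)) (i * (T / 2 ^ k) + T / 2 ^ k) := by
  have hh : 0 < T / 2 ^ k := by positivity
  have hpow : (2 : ℝ) ^ k * (T / 2 ^ k) = T := by field_simp
  rcases hs.2.lt_or_eq with hsT | rfl
  · refine ⟨⌊s / (T / 2 ^ k)⌋₊, ?_, ?_, ?_⟩
    · rw [Nat.floor_lt (div_nonneg hs.1 hh.le), div_lt_iff₀ hh]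
      push_cast
      rwa [hpow]
    · rw [← le_div_iff₀ hh]
      exact Nat.floor_le (div_nonneg hs.1 hh.le)
    · have := (Nat.lt_floor_add_one (s / (T / 2 ^ k))).le
      rw [div_le_iff₀ hh] at this
      linarith
  · have h1 : 1 ≤ 2 ^ k := Nat.one_le_two_pow
    refine ⟨2 ^ k - 1, by lia, ?_⟩
    push_cast [h1]
    rw [sub_mul, hpow]
    constructor <;> linarith

theorem cell_add_le {T : ℝ} (hT : 0 < T) {k i : ℕ} (hi : i < 2 ^ k) :
    i * (T / 2 ^ k) + T / 2 ^ k ≤ T := by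
  have hi' : (i : ℝ) + 1 ≤ 2 ^ k := by exact_mod_cast hi
  have hpow : (2 : ℝ) ^ k * (T / 2 ^ k) = T := by field_simp
  calc i * (T / 2 ^ k) + T / 2 ^ k = (i + 1) * (T / 2 ^ k) := by ring
    _ ≤ 2 ^ k * (T / 2 ^ k) := by gcongr
    _ = T := hpow

/-- Comparison of the bound on a cell of length `ρ` with the gauge at radius `r`. It uses `1 ≤ D`,
`r ≤ 1` and `1 ≤ ℓ` to pass from the exponents `α` and `α * (1 + θ)` to the larger ones
`α * D` and `α * (D + θ)`. -/
theorem gauge_le {α θ D c r ρ ℓ N : ℝ} (hα : 0 < α) (hθ : 0 ≤ θ) (hD : 1 ≤ D) (hc : 0 < c)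
    (hr : 0 < r) (hr1 : r ≤ 1) (hrρ : r ≤ 2 * ρ) (hℓ : 1 ≤ ℓ) (hN : 0 < N) (hNℓ : N ≤ 7 * ℓ) :
    c * 2 ^ (-α) * 7 ^ (-(α * (1 + θ))) / 2 * (r ^ (α * D) * ℓ ^ (-(α * (D + θ)))) ≤
      c * ρ ^ α * N ^ (-(α * (1 + θ))) / 2 := by
  have hρ : 0 < ρ := by linarith
  have h1 : 2 ^ (-α) * r ^ (α * D) ≤ ρ ^ α := by
    calc 2 ^ (-α) * r ^ (α * D) ≤ 2 ^ (-α) * r ^ α := by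
          gcongr 2 ^ (-α) * ?_
          exact Real.rpow_le_rpow_of_exponent_ge hr hr1 (by nlinarith)
      _ ≤ 2 ^ (-α) * (2 * ρ) ^ α := by gcongr
      _ = ρ ^ α := by
          rw [Real.mul_rpow zero_le_two hρ.le, ← mul_assoc, ← Real.rpow_add zero_lt_two,
            neg_add_cancel, Real.rpow_zero, one_mul]
  have h2 : 7 ^ (-(α * (1 + θ))) * ℓ ^ (-(α * (D + θ))) ≤ N ^ (-(α * (1 + θ))) := by
    calc 7 ^ (-(α * (1 + θ))) * ℓ ^ (-(α * (D + θ)))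
        ≤ 7 ^ (-(α * (1 + θ))) * ℓ ^ (-(α * (1 + θ))) := by
          gcongr 7 ^ (-(α * (1 + θ))) * ?_
          exact Real.rpow_le_rpow_of_exponent_le hℓ (by nlinarith)
      _ = (7 * ℓ) ^ (-(α * (1 + θ))) := by
          rw [Real.mul_rpow (by norm_num) (by linarith)]
      _ ≤ N ^ (-(α * (1 + θ))) := by
          refine Real.rpow_le_rpow_of_nonpos hN hNℓ ?_
          nlinarith
  calc c * 2 ^ (-α) * 7 ^ (-(α * (1 + θ))) / 2 * (r ^ (α * D) * ℓ ^ (-(α * (D + θ))))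
      = c / 2 * ((2 ^ (-α) * r ^ (α * D)) * (7 ^ (-(α * (1 + θ))) * ℓ ^ (-(α * (D + θ))))) := by
        ring
    _ ≤ c / 2 * (ρ ^ α * N ^ (-(α * (1 + θ)))) := by
        refine mul_le_mul_of_nonneg_left (mul_le_mul h1 h2 ?_ ?_) (by linarith) <;> positivity
    _ = c * ρ ^ α * N ^ (-(α * (1 + θ))) / 2 := by ring

/-! ### Lower bounds for the oscillation -/

/-- Almost sure lower bounds for the oscillation of `X`, at a fixed time and uniformly in time. -/
theorem exists_oscillation_lower_bound {Ω : Type*} [MeasurableSpace Ω] {P : Measure Ω}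
    [IsProbabilityMeasure P] {d : ℕ} (hd : 1 ≤ d) {T : ℝ} (hT : 0 < T)
    {X : ℝ → Ω → EuclideanSpace ℝ (Fin d)} {α θ : ℝ} (hα : 0 < α) (hθ : 0 ≤ θ)
    (hXmeas : ∀ t ∈ Icc 0 T, Measurable (X t)) (hA1 : CharFunCondition P T X α θ) :
    ∃ C : ℝ, 0 < C ∧
      (∀ s ∈ Icc 0 T, ∀ᵐ ω ∂P, ∀ᶠ r in 𝓝[>] 0, ∃ t ∈ Ioo (s - r) (s + r) ∩ Icc 0 T,
        C * (r ^ (α * (d : ℝ)) * (Real.log (Real.log r⁻¹)) ^ (-(α * ((d : ℝ) + θ)))) ≤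
          ‖X t ω - X s ω‖) ∧
      (∀ᵐ ω ∂P, ∀ᶠ r in 𝓝[>] 0, ∀ s ∈ Icc 0 T, ∃ t ∈ Ioo (s - r) (s + r) ∩ Icc 0 T,
        C * (r ^ (α * (d : ℝ)) * (Real.log r⁻¹) ^ (-(α * ((d : ℝ) + θ)))) ≤
          ‖X t ω - X s ω‖) := by
  have hd' : (1 : ℝ) ≤ d := by exact_mod_cast hd
  let l : Fin d := ⟨0, hd⟩
  obtain ⟨c, hc, hP⟩ := exists_measure_smallIncrements_le_exp hα hθ hXmeas hA1 l
  refine ⟨c * 2 ^ (-α) * 7 ^ (-(α * (1 + θ))) / 2, by positivity, ?_⟩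
  -- `A n k i` is the small ball event, with `n` increments, on the `i`-th cell of length
  -- `T / 2 ^ k`.
  let A : ℕ → ℕ → ℕ → Set Ω := fun n k i => smallIncrements X l (i * (T / 2 ^ k)) (T / 2 ^ k) n
    (c * (T / 2 ^ k) ^ α * ((n : ℝ) + 2) ^ (-(α * (1 + θ))))
  have hPA : ∀ n k i, 1 ≤ n → i < 2 ^ k → P (A n k i) ≤ ENNReal.ofReal (Real.exp (-(2 * n))) :=
    fun n k i hn hi => hP n _ _ hn (by positivity) (by positivity) (cell_add_le hT hi)
  have hlow : ∀ {n k i : ℕ} {ω : Ω} {s r ℓ : ℝ}, ω ∉ A n k i → i < 2 ^ k →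
      s ∈ Icc (i * (T / 2 ^ k)) (i * (T / 2 ^ k) + T / 2 ^ k) → T / 2 ^ k < r →
      r ≤ 2 * (T / 2 ^ k) → r ≤ 1 → 1 ≤ ℓ → (n : ℝ) + 2 ≤ 7 * ℓ →
      ∃ t ∈ Ioo (s - r) (s + r) ∩ Icc 0 T,
        c * 2 ^ (-α) * 7 ^ (-(α * (1 + θ))) / 2 *
          (r ^ (α * (d : ℝ)) * ℓ ^ (-(α * ((d : ℝ) + θ)))) ≤ ‖X t ω - X s ω‖ := by
    intro n k i ω s r ℓ hω hi hs hkr hrk hr1 hℓ hn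
    have hh : 0 < T / 2 ^ k := by positivity
    obtain ⟨t, ht, hle⟩ := exists_norm_sub_ge_of_notMem_smallIncrements hh hω (X s ω)
    have hi0 : 0 ≤ i * (T / 2 ^ k) := by positivity
    refine ⟨t, ⟨⟨by linarith [ht.1, hs.2], by linarith [ht.2, hs.1]⟩, by linarith [ht.1],
      ht.2.le.trans (cell_add_le hT hi)⟩, le_trans ?_ hle⟩
    exact gauge_le hα hθ hd' hc (hh.trans hkr) hr1 hrk hℓ (by positivity) hn
  have hr1 : ∀ᶠ r : ℝ in 𝓝[>] 0, r ≤ 1 :=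
    mem_nhdsWithin_of_mem_nhds (Iic_mem_nhds zero_lt_one)
  constructor
  · intro s hs
    choose i hi hsi using exists_dyadic_cell hT hs
    -- With this choice `exp (-2 * n k) ≤ (k + 1) ^ (-2)`, which is summable.
    let n : ℕ → ℕ := fun k => ⌈Real.log ((k : ℝ) + 1)⌉₊ + 1
    have hsum : ∑' k, P (A (n k) k (i k)) ≠ ⊤ := by
      have hsm : Summable fun k : ℕ => (((k : ℝ) + 1) ^ 2)⁻¹ := by
        have := (summable_nat_add_iff 1).2 (Real.summable_nat_pow_inv.2 one_lt_two)
        simpa using this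
      refine ne_top_of_le_ne_top hsm.tsum_ofReal_ne_top (ENNReal.tsum_le_tsum fun k => ?_)
      refine (hPA _ _ _ (by simp [n]) (hi k)).trans (ENNReal.ofReal_le_ofReal ?_)
      have hk : (0 : ℝ) < (k : ℝ) + 1 := by positivity
      have hnk : Real.log ((k : ℝ) + 1) ≤ n k := by
        simp only [n]
        push_cast
        linarith [Nat.le_ceil (Real.log ((k : ℝ) + 1))]
      rw [Real.exp_neg]
      refine inv_anti₀ (by positivity) ?_
      rw [← Real.exp_log (pow_pos hk 2), Real.exp_le_exp, Real.log_pow]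
      push_cast
      linarith
    filter_upwards [ae_eventually_notMem hsum] with ω hω
    filter_upwards [eventually_exists_dyadic hT hω, hr1,
      (Real.tendsto_log_atTop.comp tendsto_log_inv_nhdsGT_zero).eventually_ge_atTop 1]
      with r ⟨k, hkω, hkr, hrk, hklog⟩ hr1 hℓ
    refine hlow hkω (hi k) (hsi k) hkr hrk hr1 hℓ ?_
    have hk : (1 : ℝ) ≤ (k : ℝ) + 1 := by linarith [Nat.cast_nonneg (α := ℝ) k]
    have hceil := Nat.ceil_lt_add_one (Real.log_nonneg hk)
    have hlogpos : 0 < Real.log r⁻¹ := by linarith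
    have h4 : Real.log 4 ≤ 2 := by
      rw [show (4 : ℝ) = 2 ^ 2 by norm_num, Real.log_pow]
      push_cast
      linarith [Real.log_two_lt_d9]
    have hlog := Real.log_le_log (by linarith) hklog
    rw [Real.log_mul (by norm_num) hlogpos.ne'] at hlog
    simp only [n, Function.comp_apply] at hℓ ⊢
    push_cast
    linarith
  -- Here `2 ^ k * exp (-2 * (k + 1))` is dominated by a geometric series of ratio `1 / 2`.
  · have hsum : ∑' k, P (⋃ i ∈ Finset.range (2 ^ k), A (k + 1) k i) ≠ ⊤ := by
      have hgeom : Summable fun k : ℕ => (1 / 2 : ℝ) ^ k :=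
        summable_geometric_of_lt_one (by norm_num) (by norm_num)
      refine ne_top_of_le_ne_top hgeom.tsum_ofReal_ne_top (ENNReal.tsum_le_tsum fun k => ?_)
      calc P (⋃ i ∈ Finset.range (2 ^ k), A (k + 1) k i)
          ≤ ∑ i ∈ Finset.range (2 ^ k), P (A (k + 1) k i) := measure_biUnion_finset_le _ _
        _ ≤ ∑ i ∈ Finset.range (2 ^ k), ENNReal.ofReal (Real.exp (-(2 * (k + 1 : ℕ)))) :=
            Finset.sum_le_sum fun i hi => hPA _ _ _ (by lia) (Finset.mem_range.1 hi)
        _ = ENNReal.ofReal (2 ^ k * Real.exp (-(2 * (k + 1 : ℕ)))) := by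
            rw [Finset.sum_const, Finset.card_range, nsmul_eq_mul,
              ENNReal.ofReal_mul (by positivity), ENNReal.ofReal_pow zero_le_two]
            simp
        _ ≤ ENNReal.ofReal ((1 / 2) ^ k) := by
            refine ENNReal.ofReal_le_ofReal ?_
            have he : Real.exp (-2) ≤ 1 / 4 := by
              rw [Real.exp_neg, one_div]
              refine inv_anti₀ (by norm_num) ?_
              have := Real.add_one_le_exp 1
              rw [show (2 : ℝ) = 1 + 1 by norm_num, Real.exp_add]
              nlinarith
            calc (2 : ℝ) ^ k * Real.exp (-(2 * (k + 1 : ℕ)))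
                ≤ 2 ^ k * Real.exp (k * -2) := by
                  gcongr
                  push_cast
                  linarith
              _ = (2 * Real.exp (-2)) ^ k := by rw [Real.exp_nat_mul, mul_pow]
              _ ≤ (1 / 2) ^ k := by
                  gcongr
                  linarith
    filter_upwards [ae_eventually_notMem hsum] with ω hω
    filter_upwards [eventually_exists_dyadic hT hω, hr1,
      tendsto_log_inv_nhdsGT_zero.eventually_ge_atTop 1]
      with r ⟨k, hkω, hkr, hrk, hklog⟩ hr1 hℓ s hs
    obtain ⟨i, hi, hsi⟩ := exists_dyadic_cell hT hs k
    refine hlow (fun h => hkω ?_) hi hsi hkr hrk hr1 hℓ (n := k + 1) ?_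
    · exact mem_biUnion (Finset.mem_coe.2 (Finset.mem_range.2 hi)) h
    · push_cast
      linarith

/-- A derivative would force oscillations of order `r`, which are negligible against
`r ^ κ * (log r⁻¹) ^ (-β)` when `κ < 1`. -/
theorem not_differentiableWithinAt_of_oscillation {E : Type*} [NormedAddCommGroup E]
    [NormedSpace ℝ E] {f : ℝ → E} {S : Set ℝ} {s C κ β : ℝ} (hC : 0 < C) (hκ : κ < 1)
    (h : ∀ᶠ r in 𝓝[>] 0, ∃ t ∈ Ioo (s - r) (s + r) ∩ S,
      C * (r ^ κ * (Real.log r⁻¹) ^ (-β)) ≤ ‖f t - f s‖) :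
    ¬ DifferentiableWithinAt ℝ f S s := by
  intro hf
  obtain ⟨L, hLpos, hL⟩ := hf.hasDerivWithinAt.isBigO_sub.exists_pos
  have hL' := hL.bound
  rw [prod_pure, eventually_map, eventually_nhdsWithin_iff, Metric.eventually_nhds_iff] at hL'
  obtain ⟨ε, hε, hball⟩ := hL'
  have hlim : Tendsto (fun r : ℝ => Real.log r⁻¹ ^ β / (r⁻¹) ^ (1 - κ)) (𝓝[>] 0) (𝓝 0) :=
    ((isLittleO_log_rpow_rpow_atTop β (sub_pos.2 hκ)).tendsto_div_nhds_zero).comp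
      tendsto_inv_nhdsGT_zero
  have hsmall := hlim.eventually_lt_const (div_pos hC hLpos)
  have hltε : ∀ᶠ r : ℝ in 𝓝[>] 0, r < ε := mem_nhdsWithin_of_mem_nhds (Iio_mem_nhds hε)
  obtain ⟨r, ⟨t, ⟨ht, htS⟩, hCt⟩, hrlt, hr0, hrε, hlog⟩ := (h.and (hsmall.and
    ((eventually_mem_nhdsWithin (a := (0 : ℝ)) (s := Ioi 0)).and
      (hltε.and
        (tendsto_log_inv_nhdsGT_zero.eventually_gt_atTop 0))))).exists
  have hr0 : 0 < r := hr0
  have hts : |t - s| < r := by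
    rw [abs_lt]
    constructor <;> linarith [ht.1, ht.2]
  have h1 : ‖f t - f s‖ ≤ L * r := by
    refine (hball (show dist t s < ε from hts.trans hrε) htS).trans ?_
    rw [Real.norm_eq_abs]
    gcongr
  have h2 := hCt.trans h1
  rw [div_lt_div_iff₀ (by positivity) hLpos, Real.inv_rpow hr0.le] at hrlt
  rw [Real.rpow_neg hlog.le] at h2
  have hlp : 0 < Real.log r⁻¹ ^ β := Real.rpow_pos_of_pos hlog β
  have hrκ : r = r ^ κ * r ^ (1 - κ) := by
    rw [← Real.rpow_add hr0, add_sub_cancel, Real.rpow_one]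
  have hk : 0 < r ^ κ := Real.rpow_pos_of_pos hr0 κ
  have hk' : 0 < r ^ (1 - κ) := Real.rpow_pos_of_pos hr0 _
  have h3 : C * (r ^ κ * (Real.log r⁻¹ ^ β)⁻¹) ≤ L * (r ^ κ * r ^ (1 - κ)) := by
    rwa [← hrκ]
  have h4 : C ≤ L * r ^ (1 - κ) * Real.log r⁻¹ ^ β := by
    rw [← mul_le_mul_iff_right₀ (mul_pos hk (inv_pos.2 hlp))]
    calc r ^ κ * (Real.log r⁻¹ ^ β)⁻¹ * C ≤ L * (r ^ κ * r ^ (1 - κ)) := by linarith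
      _ = r ^ κ * (Real.log r⁻¹ ^ β)⁻¹ * (L * r ^ (1 - κ) * Real.log r⁻¹ ^ β) := by
        linear_combination (-(L * r ^ κ * r ^ (1 - κ))) * inv_mul_cancel₀ hlp.ne'
  have h5 : Real.log r⁻¹ ^ β * L * r ^ (1 - κ) < C := by
    calc Real.log r⁻¹ ^ β * L * r ^ (1 - κ) < C * (r ^ (1 - κ))⁻¹ * r ^ (1 - κ) := by gcongr
      _ = C := by field_simp
  linarith

theorem mainTheorem3 {Ω : Type*} [MeasurableSpace Ω] (P : Measure Ω) [IsProbabilityMeasure P]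
    (d : ℕ) (hd : 1 ≤ d) (T : ℝ) (hT : 0 < T)
    (X : ℝ → Ω → EuclideanSpace ℝ (Fin d))
    (hXmeas : ∀ t ∈ Icc 0 T, Measurable (X t))
    (hXcont : ∀ᵐ ω ∂P, ContinuousOn (fun t => X t ω) (Icc 0 T))
    (α θ ι : ℝ) (hα : α ∈ Ioo (0 : ℝ) (1 / (d : ℝ))) (hθ : 0 ≤ θ) (hι : ι ∈ Icc (0 : ℝ) 1)
    (hA1 : CharFunCondition P T X α θ) (hA2 : MomentCondition P T X α ι) :
    (∃ C : ℝ, 0 < C ∧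
      (∀ s ∈ Icc 0 T, ∀ᵐ ω ∂P,
        (C : EReal) ≤ liminf (fun r : ℝ =>
          ⨆ t ∈ Ioo (s - r) (s + r) ∩ Icc 0 T,
            ((‖X t ω - X s ω‖ / (r ^ (α * (d : ℝ)) *
              (Real.log (Real.log r⁻¹)) ^ (-(α * ((d : ℝ) + θ)))) : ℝ) : EReal)) (𝓝[>] 0)) ∧
      (∀ᵐ ω ∂P,
        (C : EReal) ≤ liminf (fun r : ℝ =>
          ⨅ s ∈ Icc 0 T, ⨆ t ∈ Ioo (s - r) (s + r) ∩ Icc 0 T,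
            ((‖X t ω - X s ω‖ / (r ^ (α * (d : ℝ)) *
              (Real.log r⁻¹) ^ (-(α * ((d : ℝ) + θ)))) : ℝ) : EReal)) (𝓝[>] 0))) ∧
    (∀ᵐ ω ∂P, ∀ s ∈ Icc 0 T, ¬ DifferentiableWithinAt ℝ (fun t => X t ω) (Icc 0 T) s) := by
  obtain ⟨C, hC, hlocal, hunif⟩ := exists_oscillation_lower_bound hd hT hα.1 hθ hXmeas hA1
  have hαd : α * d < 1 := (lt_div_iff₀ (by exact_mod_cast hd)).1 hα.2
  have hloglog : ∀ᶠ r : ℝ in 𝓝[>] 0, 0 < Real.log (Real.log r⁻¹) :=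
    (Real.tendsto_log_atTop.comp tendsto_log_inv_nhdsGT_zero).eventually_gt_atTop 0
  have hlog : ∀ᶠ r : ℝ in 𝓝[>] 0, 0 < Real.log r⁻¹ :=
    tendsto_log_inv_nhdsGT_zero.eventually_gt_atTop 0
  refine ⟨⟨C, hC, fun s hs => ?_, ?_⟩, ?_⟩
  · filter_upwards [hlocal s hs] with ω hω
    refine le_liminf_of_le (by isBoundedDefault) ?_
    filter_upwards [hω, hloglog, self_mem_nhdsWithin] with r ⟨t, ht, hle⟩ hl (hr : 0 < r)
    refine le_iSup₂_of_le t ht (EReal.coe_le_coe ?_)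
    rwa [le_div_iff₀ (by positivity)]
  · filter_upwards [hunif] with ω hω
    refine le_liminf_of_le (by isBoundedDefault) ?_
    filter_upwards [hω, hlog, self_mem_nhdsWithin] with r hr' hl (hr : 0 < r)
    refine le_iInf₂ fun s hs => ?_
    obtain ⟨t, ht, hle⟩ := hr' s hs
    refine le_iSup₂_of_le t ht (EReal.coe_le_coe ?_)
    rwa [le_div_iff₀ (by positivity)]
  · filter_upwards [hunif] with ω hω s hs
    exact not_differentiableWithinAt_of_oscillation hC hαd (hω.mono fun r hr => hr s hs)
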